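/- \textbf{Theorem (Skolem--Mahler--Lech, linear-algebraic form).} Let $K$ be a field of characteristic $0$, let $n\ge 0$ be an integer, let $\sigma\colon K^n\to K^n$ be an invertible $K$-linear map, let $v\in K^n$, and let $W$ be a $K$-linear subspace of $K^n$ of codimension $1$. Then the set $$\{m\in\mathbb{N} : \sigma^m(v)\in W\}$$ is the union of a finite set and finitely many (possibly zero) arithmetic progressions $\{a+dk : k=0,1,2,\ldots\}$ with $a,d\in\mathbb{N}$ and $d\ge 1$. Here $\mathbb{N}=\{0,1,2,\ldots\}$. -/

import Mathlib

/-- A (one-sided, infinite) arithmetic progression in the natural numbers: a set of the form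
`{a + d * k : k = 0, 1, 2, ...}` with starting point `a` and common difference `d ≥ 1`. -/
def IsNatArithProg (A : Set ℕ) : Prop :=
  ∃ a d : ℕ, 1 ≤ d ∧ A = {m | ∃ k : ℕ, m = a + d * k}

/-!
The proof follows Hansel and uses no `p`-adic analysis. As `W` is the kernel of a linear form, the
set in question is the zero set of `m ↦ w ⬝ᵥ (A ^ m *ᵥ v)` for an invertible matrix `A` over `K`.
It suffices to find a period `N` such that this zero set meets every progression `r + N * ℕ` in a
finite set or contains it (`IsZeroSetPeriod`, `IsZeroSetPeriod.eq_sUnion_union`).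

For an integer matrix with `det A ≠ 0`, let `p` be a prime not dividing `det A`. The reduction of
`A` modulo `p ^ 2` lies in a finite group, so `A ^ N = 1 + p ^ 2 * B` for some `N > 0`, and
along `r + N * k` the sequence is `∑ j, (k.choose j) * p ^ (2 * j) * d j` with integers `d j`.
Such a sequence with infinitely many zeros is zero (`sum_choose_mul_pow_eq_zero_of_infinite`): it agrees on long initial
segments with polynomials whose coefficients of index at least `k` are divisible by `p ^ k`, up to
denominators prime to `p`, and splitting off `k` of the zeros shows that all its values are
divisible by `p ^ k`.

If the entries are polynomials over `ℤ`, they are specialized at all integer points in one residue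
class modulo `p ^ 2`. The period depends only on the reduction modulo `p ^ 2`, so it is common to
all these specializations, and a polynomial vanishing at all these points is zero
(`exists_isZeroSetPeriod_mvPolynomial`).

A field `K` of characteristic zero is algebraic over the fraction field `F` of a polynomial ring
over `ℤ`, by a transcendence basis. The entries lie in a finite extension of `F`, and restriction of
scalars to `F` replaces one linear form by finitely many
(`exists_isZeroSetPeriod_finiteDimensional`).
-/

/-! ### Sequences given by binomial expansions -/

/-- The denominators `j!` are prime to `p` up to a factor `p ^ j`, uniformly for `j ≤ n`: the
prime-to-`p` part of `n!` clears all of them. -/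
theorem exists_coprime_factorial_dvd_mul_pow {p : ℕ} (hp : p.Prime) (n : ℕ) :
    ∃ u : ℕ, u.Coprime p ∧ ∀ j ≤ n, j.factorial ∣ u * p ^ j := by
  have : Fact p.Prime := ⟨hp⟩
  refine ⟨n.factorial / p ^ n.factorial.factorization p,
    (Nat.coprime_ordCompl hp n.factorial_ne_zero).symm, fun j hj => ?_⟩
  rw [← Nat.ordProj_mul_ordCompl_eq_self j.factorial p, mul_comm]
  refine mul_dvd_mul (Nat.ordCompl_dvd_ordCompl_of_dvd (Nat.factorial_dvd_factorial hj) p)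
    (pow_dvd_pow p ?_)
  rw [Nat.factorization_def _ hp]
  exact padicValNat_factorial_le p j

open Polynomial in
/-- If an integral combination of the falling factorials, with `j`-th coefficient divisible by
`p ^ j`, has `k` roots among the naturals, then all its values are divisible by `p ^ k`. Modulo
`p ^ k` the polynomial has degree less than `k`, so dividing by the monic `∏ (X - s)` over the roots
leaves a quotient divisible by `p ^ k`, and the remainder vanishes as it has too many roots. -/
theorem pow_dvd_eval_of_card_roots {p k : ℕ} (n : ℕ) (b : ℕ → ℤ) (T : Finset ℕ) (hT : T.card = k)
    (hzero : ∀ s ∈ T, (∑ j ∈ Finset.range n, C (b j * (p : ℤ) ^ j) * descPochhammer ℤ j).eval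
      (s : ℤ) = 0) (x : ℤ) :
    (p : ℤ) ^ k ∣ (∑ j ∈ Finset.range n, C (b j * (p : ℤ) ^ j) * descPochhammer ℤ j).eval x := by
  classical
  set P : ℤ[X] := ∑ j ∈ Finset.range n, C (b j * (p : ℤ) ^ j) * descPochhammer ℤ j with hP
  -- The terms of index at least `k` carry a factor `p ^ k`; the others have degree below `k`.
  obtain ⟨low, high, hlow, hsplit⟩ : ∃ low high : ℤ[X], low.degree < (k : WithBot ℕ) ∧
      P = low + C ((p : ℤ) ^ k) * high := by
    refine ⟨∑ j ∈ Finset.range n with j < k, C (b j * (p : ℤ) ^ j) * descPochhammer ℤ j,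
      ∑ j ∈ Finset.range n with ¬ j < k, C (b j * (p : ℤ) ^ (j - k)) * descPochhammer ℤ j, ?_, ?_⟩
    · refine (degree_sum_le _ _).trans_lt ((Finset.sup_lt_iff (WithBot.bot_lt_coe k)).2 ?_)
      intro j hj
      rw [← smul_eq_C_mul]
      refine (degree_smul_le _ _).trans_lt (degree_le_natDegree.trans_lt ?_)
      rw [descPochhammer_natDegree]
      exact WithBot.coe_lt_coe.2 (Finset.mem_filter.1 hj).2
    · rw [hP, ← Finset.sum_filter_add_sum_filter_not _ (fun j => j < k), Finset.mul_sum]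
      congr 1
      refine Finset.sum_congr rfl fun j hj => ?_
      have hkj : k ≤ j := not_lt.1 (Finset.mem_filter.1 hj).2
      rw [← mul_assoc, ← C_mul]
      congr 2
      rw [← Nat.sub_add_cancel hkj, pow_add, Nat.add_sub_cancel]
      ring
  set g : ℤ[X] := ∏ s ∈ T, (X - C (s : ℤ)) with hg
  have hgm : g.Monic := monic_prod_of_monic _ _ fun s _ => monic_X_sub_C _
  have hgd : g.degree = (k : WithBot ℕ) := by
    rw [hg, degree_prod, Finset.sum_congr rfl fun (s : ℕ) _ => degree_X_sub_C (s : ℤ)]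
    simp [hT]
  have hdiv : high = high %ₘ g + g * (high /ₘ g) := (modByMonic_add_div high g).symm
  have hroot : ∀ s ∈ T, g.eval (s : ℤ) = 0 := fun s hs => by
    rw [hg, eval_prod]
    exact Finset.prod_eq_zero hs (by simp)
  -- The remainder of `P` on division by `g` has degree below `k` and `k` roots.
  have hrem : low + C ((p : ℤ) ^ k) * (high %ₘ g) = 0 := by
    refine eq_zero_of_degree_lt_of_eval_finset_eq_zero
      (T.map (Nat.castEmbedding : ℕ ↪ ℤ)) ?_ ?_
    · rw [Finset.card_map, hT]
      refine (degree_add_le _ _).trans_lt (max_lt hlow ?_)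
      rw [← smul_eq_C_mul]
      exact (degree_smul_le _ _).trans_lt (hgd ▸ degree_modByMonic_lt _ hgm)
    · intro y hy
      obtain ⟨s, hs, rfl⟩ := Finset.mem_map.1 hy
      have h := hzero s hs
      rw [hsplit, hdiv] at h
      simp only [eval_add, eval_mul, hroot s hs, zero_mul, add_zero] at h
      simpa using h
  have hP' : P = C ((p : ℤ) ^ k) * (g * (high /ₘ g)) := by
    calc P = low + C ((p : ℤ) ^ k) * (high %ₘ g + g * (high /ₘ g)) := by rw [← hdiv]; exact hsplit
      _ = (low + C ((p : ℤ) ^ k) * (high %ₘ g)) + C ((p : ℤ) ^ k) * (g * (high /ₘ g)) := by ring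
      _ = _ := by rw [hrem, zero_add]
  rw [hP', eval_mul, eval_C]
  exact dvd_mul_right _ _

open Polynomial in
/-- The sequence `t ↦ ∑ j, (t.choose j) * p ^ (2 * j) * d j` vanishes identically as soon as it has
infinitely many zeros. Interpolating it by a polynomial at `0, …, n` costs the denominators `j!`,
which absorb one factor `p ^ j` each; the other factor makes each value divisible by every power
of `p`. The exponent `2` is what makes this work for all primes, `p = 2` included. -/
theorem sum_choose_mul_pow_eq_zero_of_infinite {p : ℕ} (hp : p.Prime) (d : ℕ → ℤ)
    (hinf : {t : ℕ | ∑ j ∈ Finset.range (t + 1), (t.choose j : ℤ) * ((p : ℤ) ^ 2) ^ j * d j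
      = 0}.Infinite) (t : ℕ) :
    ∑ j ∈ Finset.range (t + 1), (t.choose j : ℤ) * ((p : ℤ) ^ 2) ^ j * d j = 0 := by
  set f : ℕ → ℤ := fun t =>
    ∑ j ∈ Finset.range (t + 1), (t.choose j : ℤ) * ((p : ℤ) ^ 2) ^ j * d j with hf
  have key : ∀ k : ℕ, (p : ℤ) ^ k ∣ f t := by
    intro k
    obtain ⟨T, hTsub, hTcard⟩ := hinf.exists_subset_card_eq k
    set n : ℕ := max t (T.sup id)
    obtain ⟨u, hu, hdvd⟩ := exists_coprime_factorial_dvd_mul_pow hp n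
    choose! c hc using hdvd
    -- `u * f` agrees on `0, …, n` with a polynomial over `ℤ`, as `j! * choose s j` is the falling
    -- factorial of `s`.
    have heval : ∀ s ≤ n, (∑ j ∈ Finset.range (n + 1),
        C (d j * (c j : ℤ) * (p : ℤ) ^ j) * descPochhammer ℤ j).eval (s : ℤ) = u * f s := by
      intro s hs
      have hext : f s = ∑ j ∈ Finset.range (n + 1), (s.choose j : ℤ) * ((p : ℤ) ^ 2) ^ j * d j := by
        refine Finset.sum_subset (Finset.range_mono (by omega)) fun j _ hj => ?_
        rw [Nat.choose_eq_zero_of_lt (by simpa using hj)]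
        simp
      rw [hext, eval_finsetSum, Finset.mul_sum]
      refine Finset.sum_congr rfl fun j hj => ?_
      have hcj : ((u : ℤ) * (p : ℤ) ^ j) = j.factorial * c j := by
        exact_mod_cast hc j (Nat.lt_succ_iff.1 (Finset.mem_range.1 hj))
      rw [eval_mul, eval_C, descPochhammer_eval_eq_descFactorial,
        Nat.descFactorial_eq_factorial_mul_choose, Nat.cast_mul]
      linear_combination (-(d j * (p : ℤ) ^ j * (s.choose j : ℤ))) * hcj
    have hdiv := pow_dvd_eval_of_card_roots (p := p) (n + 1) (fun j => d j * (c j : ℤ)) T hTcard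
      (fun s hs => by
        rw [heval s ((Finset.le_sup (f := id) hs).trans (le_max_right _ _)),
          show f s = 0 from hTsub hs, mul_zero]) (t : ℤ)
    rw [heval t (le_max_left _ _)] at hdiv
    exact (IsCoprime.pow_left (Nat.isCoprime_iff_coprime.2 hu.symm)).dvd_of_dvd_mul_left hdiv
  by_contra hne
  have h1 : p ^ (f t).natAbs ∣ (f t).natAbs := by
    have := Int.natAbs_dvd_natAbs.2 (key (f t).natAbs)
    rwa [Int.natAbs_pow, Int.natAbs_natCast] at this
  exact absurd (Nat.le_of_dvd (Int.natAbs_pos.2 hne) h1) (not_le.2 (Nat.lt_pow_self hp.one_lt))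

/-! ### Periods of zero sets -/

/-- `N` is positive and the set `Z` meets each progression `r + N * ℕ` in a finite set or contains
it. Offsets `r ≥ N` give tails of the progressions with `r < N`, so allowing them does not
strengthen the condition. -/
def IsZeroSetPeriod (N : ℕ) (Z : Set ℕ) : Prop :=
  0 < N ∧ ∀ r, {k | r + N * k ∈ Z}.Finite ∨ ∀ k, r + N * k ∈ Z

namespace IsZeroSetPeriod

theorem mul_right {N : ℕ} {Z : Set ℕ} (h : IsZeroSetPeriod N Z) {N' : ℕ} (hN' : 0 < N') :
    IsZeroSetPeriod (N * N') Z := by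
  refine ⟨Nat.mul_pos h.1 hN', fun r => (h.2 r).imp (fun hfin => ?_) fun hall k => ?_⟩
  · refine (hfin.preimage (f := fun k => N' * k)
      (fun a _ b _ hab => Nat.eq_of_mul_eq_mul_left hN' hab)).subset fun k hk => ?_
    simpa [mul_assoc] using hk
  · rw [mul_assoc]
    exact hall _

theorem inter {N N' : ℕ} {Z Z' : Set ℕ} (h : IsZeroSetPeriod N Z) (h' : IsZeroSetPeriod N' Z') :
    IsZeroSetPeriod (N * N') (Z ∩ Z') := by
  have h₁ := h.mul_right h'.1
  have h₂ := h'.mul_right h.1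
  rw [mul_comm] at h₂
  refine ⟨h₁.1, fun r => ?_⟩
  rcases h₁.2 r with hf | ha
  · exact .inl (hf.subset fun k hk => hk.1)
  rcases h₂.2 r with hf | ha'
  · exact .inl (hf.subset fun k hk => hk.2)
  · exact .inr fun k => ⟨ha k, ha' k⟩

theorem exists_iInter {ι : Type*} [Finite ι] {Z : ι → Set ℕ}
    (h : ∀ i, ∃ N, IsZeroSetPeriod N (Z i)) : ∃ N, IsZeroSetPeriod N (⋂ i, Z i) := by
  classical
  have := Fintype.ofFinite ι
  have key : ∀ s : Finset ι, ∃ N, IsZeroSetPeriod N (⋂ i ∈ s, Z i) := by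
    intro s
    induction s using Finset.induction_on with
    | empty => exact ⟨1, one_pos, fun r => .inr (by simp)⟩
    | insert a s _ ih =>
      obtain ⟨N, hN⟩ := ih
      obtain ⟨N', hN'⟩ := h a
      exact ⟨N' * N, by rw [Finset.set_biInter_insert]; exact hN'.inter hN⟩
  simpa using key Finset.univ

theorem eq_sUnion_union {N : ℕ} {Z : Set ℕ} (h : IsZeroSetPeriod N Z) :
    ∃ (P : Set (Set ℕ)) (F : Set ℕ), P.Finite ∧ (∀ A ∈ P, IsNatArithProg A) ∧ F.Finite ∧
      Z = ⋃₀ P ∪ F := by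
  set prog : ℕ → Set ℕ := fun r => {m | ∃ k, m = r + N * k}
  set I : Set ℕ := {r | r < N ∧ ∀ k, r + N * k ∈ Z}
  set J : Set ℕ := {r | r < N ∧ {k | r + N * k ∈ Z}.Finite}
  refine ⟨prog '' I, ⋃ r ∈ J, (fun k => r + N * k) '' {k | r + N * k ∈ Z}, ?_, ?_, ?_, ?_⟩
  · exact ((Set.finite_Iio N).subset fun r hr => hr.1).image _
  · rintro _ ⟨r, _, rfl⟩
    exact ⟨r, N, h.1, rfl⟩
  · exact ((Set.finite_Iio N).subset fun r hr => hr.1).biUnion fun r hr => hr.2.image _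
  · ext m
    constructor
    · intro hm
      have hdiv : m % N + N * (m / N) = m := Nat.mod_add_div m N
      have hlt : m % N < N := Nat.mod_lt m h.1
      rcases h.2 (m % N) with hf | ha
      · refine .inr (Set.mem_iUnion₂.2 ⟨m % N, ⟨hlt, hf⟩, m / N, ?_, hdiv⟩)
        simpa [hdiv] using hm
      · exact .inl ⟨_, ⟨m % N, ⟨hlt, ha⟩, rfl⟩, m / N, hdiv.symm⟩
    · rintro (⟨_, ⟨r, hr, rfl⟩, k, rfl⟩ | hm)
      · exact hr.2 k
      · obtain ⟨r, _, k, hk, rfl⟩ := Set.mem_iUnion₂.1 hm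
        exact hk

end IsZeroSetPeriod

/-! ### Integer and polynomial matrices -/

open Matrix

/-- If `M ^ N = 1 + p ^ 2 * B`, the binomial expansion of `M ^ (r + N * k)` has the shape to which
`sum_choose_mul_pow_eq_zero_of_infinite` applies. -/
theorem isZeroSetPeriod_int {κ : Type*} [Fintype κ] [DecidableEq κ] {p N : ℕ} (hp : p.Prime)
    (hN : 0 < N) {M B : Matrix κ κ ℤ} (hM : M ^ N = 1 + ((p : ℤ) ^ 2) • B) (w v : κ → ℤ) :
    IsZeroSetPeriod N {m | w ⬝ᵥ (M ^ m *ᵥ v) = 0} := by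
  refine ⟨hN, fun r => ?_⟩
  have key : ∀ k, w ⬝ᵥ (M ^ (r + N * k) *ᵥ v) = ∑ j ∈ Finset.range (k + 1),
      (k.choose j : ℤ) * ((p : ℤ) ^ 2) ^ j * (w ⬝ᵥ ((M ^ r * B ^ j) *ᵥ v)) := by
    intro k
    have hpow : M ^ (r + N * k) = ∑ j ∈ Finset.range (k + 1),
        ((k.choose j : ℤ) * ((p : ℤ) ^ 2) ^ j) • (M ^ r * B ^ j) := by
      rw [pow_add, pow_mul, hM, add_comm, (Commute.one_right _).add_pow, Finset.mul_sum]
      refine Finset.sum_congr rfl fun j _ => ?_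
      rw [one_pow, mul_one, smul_pow, ← nsmul_eq_mul', mul_smul, ← natCast_zsmul,
        mul_smul_comm, mul_smul_comm]
    rw [hpow, sum_mulVec, dotProduct_sum]
    refine Finset.sum_congr rfl fun j _ => ?_
    rw [smul_mulVec, dotProduct_smul, smul_eq_mul]
  simp only [Set.mem_ofPred_eq, key]
  rw [or_iff_not_imp_left]
  exact fun hinf k => sum_choose_mul_pow_eq_zero_of_infinite hp _ hinf k

theorem RingHom.map_dotProduct_pow_mulVec {R R' κ : Type*} [CommRing R] [CommRing R'] [Fintype κ]
    [DecidableEq κ] (f : R →+* R') (A : Matrix κ κ R) (w v : κ → R) (m : ℕ) :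
    f (w ⬝ᵥ (A ^ m *ᵥ v)) = (f ∘ w) ⬝ᵥ ((A.map f) ^ m *ᵥ (f ∘ v)) := by
  rw [RingHom.map_dotProduct, ← Matrix.map_pow]
  congr 1
  ext i
  exact RingHom.map_mulVec f _ _ i

/-- Specialize the variables at the points `c + p ^ 2 * e`, where `c` is a point with
`det A (c) ≠ 0` and `p` a prime not dividing this value. All these specializations have the same
reduction in the finite group `GL (ZMod (p ^ 2))`, hence a common period `N`, the order of that
group; and they are dense enough to detect that a polynomial is zero. -/
theorem exists_isZeroSetPeriod_mvPolynomial {ι κ : Type*} [Fintype κ] [DecidableEq κ]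
    (A : Matrix κ κ (MvPolynomial ι ℤ)) (hA : A.det ≠ 0) (w v : κ → MvPolynomial ι ℤ) :
    ∃ N, IsZeroSetPeriod N {m | w ⬝ᵥ (A ^ m *ᵥ v) = 0} := by
  obtain ⟨c, hc⟩ : ∃ c : ι → ℤ, MvPolynomial.eval c A.det ≠ 0 := by
    by_contra! h
    exact hA (MvPolynomial.funext fun x => by rw [h x, map_zero])
  obtain ⟨p, hple, hp⟩ := Nat.exists_infinite_primes ((MvPolynomial.eval c A.det).natAbs + 1)
  have hcop : IsCoprime (MvPolynomial.eval c A.det) ((p ^ 2 : ℕ) : ℤ) := by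
    rw [Int.isCoprime_iff_nat_coprime, Int.natAbs_natCast]
    refine Nat.Coprime.pow_right 2 ((Nat.Prime.coprime_iff_not_dvd hp).2 fun hdvd => ?_).symm
    exact absurd (Nat.le_of_dvd (Int.natAbs_pos.2 hc) hdvd) (by omega)
  have : NeZero (p ^ 2) := ⟨pow_ne_zero 2 hp.ne_zero⟩
  -- `red` is reduction modulo `p ^ 2`, and `S` the set of points congruent to `c`.
  set red : ℤ →+* ZMod (p ^ 2) := Int.castRingHom _ with hred
  set S : Set (ι → ℤ) := Set.univ.pi fun i => Set.range fun e : ℤ => c i + (p : ℤ) ^ 2 * e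
  have hp0 : ((p : ZMod (p ^ 2)) ^ 2) = 0 := by exact_mod_cast ZMod.natCast_self (p ^ 2)
  have hagree : ∀ x ∈ S, red.comp (MvPolynomial.eval x) = red.comp (MvPolynomial.eval c) := by
    intro x hx
    refine MvPolynomial.ringHom_ext (by simp) fun i => ?_
    obtain ⟨e, he⟩ := hx i trivial
    simp [← he, hred, hp0]
  set R : Matrix κ κ (ZMod (p ^ 2)) := A.map (red.comp (MvPolynomial.eval c)) with hR
  have hRunit : IsUnit R := by
    rw [Matrix.isUnit_iff_isUnit_det, hR, ← RingHom.mapMatrix_apply, ← RingHom.map_det]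
    obtain ⟨a, b, hab⟩ := hcop
    refine IsUnit.of_mul_eq_one_right (red a) ?_
    have := congrArg red hab
    simpa [hred, hp0] using this
  obtain ⟨U, hU⟩ := hRunit
  have hRpow : R ^ Nat.card (Matrix κ κ (ZMod (p ^ 2)))ˣ = 1 := by
    rw [← hU, ← Units.val_pow_eq_pow_val, pow_card_eq_one', Units.val_one]
  set N := Nat.card (Matrix κ κ (ZMod (p ^ 2)))ˣ
  have hN : 0 < N := Nat.card_pos
  have hspec : ∀ x ∈ S, IsZeroSetPeriod N
      {m | MvPolynomial.eval x (w ⬝ᵥ (A ^ m *ᵥ v)) = 0} := by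
    intro x hx
    have hdvd : ∀ i j, ((p : ℤ) ^ 2) ∣ ((A.map (MvPolynomial.eval x)) ^ N - 1) i j := by
      intro i j
      have h0 : red.mapMatrix ((A.map (MvPolynomial.eval x)) ^ N - 1) = 0 := by
        rw [map_sub, map_pow, map_one, RingHom.mapMatrix_apply, Matrix.map_map,
          ← RingHom.coe_comp, hagree x hx, ← hR, hRpow, sub_self]
      have := congrFun (congrFun h0 i) j
      exact_mod_cast (ZMod.intCast_zmod_eq_zero_iff_dvd _ _).1 this
    choose B hB using hdvd
    have hM : (A.map (MvPolynomial.eval x)) ^ N = 1 + ((p : ℤ) ^ 2) • (Matrix.of B) := by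
      rw [← sub_eq_iff_eq_add']
      ext i j
      exact hB i j
    simpa only [RingHom.map_dotProduct_pow_mulVec] using
      isZeroSetPeriod_int hp hN hM (MvPolynomial.eval x ∘ w) (MvPolynomial.eval x ∘ v)
  refine ⟨N, hN, fun r => ?_⟩
  rw [or_iff_not_imp_left]
  intro hinf k
  -- The zeros along `r + N * ℕ` persist under every specialization, and `S` is a box with infinite
  -- sides.
  refine MvPolynomial.funext_set
    (fun i => Set.range fun e : ℤ => c i + (p : ℤ) ^ 2 * e) (fun i => ?_) fun x hx => ?_
  · refine Set.infinite_range_of_injective fun a b hab => ?_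
    have hp2 : (p : ℤ) ^ 2 ≠ 0 := pow_ne_zero 2 (by exact_mod_cast hp.ne_zero)
    exact mul_left_cancel₀ hp2 (add_left_cancel hab)
  · rw [map_zero]
    refine (((hspec x hx).2 r).resolve_left fun hfin => hinf (hfin.subset fun k hk => ?_)) k
    simp only [Set.mem_ofPred_eq] at hk ⊢
    rw [hk, map_zero]

/-! ### Descent to fields of characteristic zero -/

/-- Clearing denominators multiplies `A`, `w` and `v` by nonzero scalars, which does not change the
zeros of `w ⬝ᵥ (A ^ m *ᵥ v)`. -/
theorem exists_isZeroSetPeriod_fractionRing {ι κ S F : Type*} [CommRing S] [IsDomain S] [Field F]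
    [Algebra S F] [IsFractionRing S F] [Fintype κ] [DecidableEq κ]
    (e : S ≃+* MvPolynomial ι ℤ) (A : Matrix κ κ F) (hA : A.det ≠ 0) (w v : κ → F) :
    ∃ N, IsZeroSetPeriod N {m | w ⬝ᵥ (A ^ m *ᵥ v) = 0} := by
  obtain ⟨a, ha⟩ := IsLocalization.exist_integer_multiples_of_finite (nonZeroDivisors S)
    (fun ij : κ × κ => A ij.1 ij.2)
  obtain ⟨b, hb⟩ := IsLocalization.exist_integer_multiples_of_finite (nonZeroDivisors S) w
  obtain ⟨c, hc⟩ := IsLocalization.exist_integer_multiples_of_finite (nonZeroDivisors S) v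
  choose A' hA' using fun i j => ha (i, j)
  choose w' hw' using hb
  choose v' hv' using hc
  have hne : ∀ s : nonZeroDivisors S, algebraMap S F s ≠ 0 := fun s =>
    IsFractionRing.to_map_ne_zero_of_mem_nonZeroDivisors s.2
  have hAmap : (Matrix.of A').map (algebraMap S F) = algebraMap S F a • A := by
    ext i j
    simpa [Algebra.smul_def] using hA' i j
  have hwmap : algebraMap S F ∘ w' = algebraMap S F b • w := by
    ext i
    simpa [Algebra.smul_def] using hw' i
  have hvmap : algebraMap S F ∘ v' = algebraMap S F c • v := by
    ext i
    simpa [Algebra.smul_def] using hv' i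
  have hdet : ((Matrix.of A').map e).det ≠ 0 := by
    have h1 : algebraMap S F (Matrix.of A').det ≠ 0 := by
      rw [RingHom.map_det, RingHom.mapMatrix_apply, hAmap, det_smul]
      exact mul_ne_zero (pow_ne_zero _ (hne a)) hA
    have h2 : e (Matrix.of A').det ≠ 0 := fun h => h1 (by
      rw [(map_eq_zero_iff e e.injective).1 h, map_zero])
    rwa [← RingEquiv.coe_toRingHom, RingHom.map_det, RingHom.mapMatrix_apply] at h2
  obtain ⟨N, hN⟩ := exists_isZeroSetPeriod_mvPolynomial _ hdet (e ∘ w') (e ∘ v')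
  refine ⟨N, ?_⟩
  convert hN using 3 with m
  have h1 := (algebraMap S F).map_dotProduct_pow_mulVec (Matrix.of A') w' v' m
  have h2 := (e : S →+* MvPolynomial ι ℤ).map_dotProduct_pow_mulVec (Matrix.of A') w' v' m
  simp only [RingEquiv.coe_toRingHom] at h2
  rw [← h2, map_eq_zero_iff e e.injective, ← map_eq_zero_iff _ (IsFractionRing.injective S F), h1,
    hAmap, hwmap, hvmap, smul_pow, smul_mulVec, mulVec_smul, smul_dotProduct, dotProduct_smul,
    dotProduct_smul]
  simp [hne]

theorem LinearMap.dotProduct_toMatrix_pow_mulVec_repr {F V κ : Type*} [Field F] [AddCommGroup V]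
    [Module F V] [Fintype κ] [DecidableEq κ] (b : Module.Basis κ F V) (T : V →ₗ[F] V)
    (φ : V →ₗ[F] F) (v : V) (m : ℕ) :
    (fun i => φ (b i)) ⬝ᵥ (LinearMap.toMatrix b b T ^ m *ᵥ b.repr v) = φ ((T ^ m) v) := by
  rw [LinearMap.toMatrix_pow, LinearMap.toMatrix_mulVec_repr, dotProduct]
  conv_rhs => rw [← b.sum_repr ((T ^ m) v), map_sum]
  simp [mul_comm]

theorem LinearMap.det_toMatrix_ne_zero_of_injective {F V κ : Type*} [Field F] [AddCommGroup V]
    [Module F V] [Fintype κ] [DecidableEq κ] (b : Module.Basis κ F V) {T : V →ₗ[F] V}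
    (hT : Function.Injective T) : (LinearMap.toMatrix b b T).det ≠ 0 := by
  rw [LinearMap.det_toMatrix]
  exact fun h => (LinearMap.bot_lt_ker_of_det_eq_zero h).ne' (LinearMap.ker_eq_bot.2 hT)

/-- Over a finite extension `L` of `F`, regard `A` as an `F`-linear map of `κ → L`. An element of
`L` is zero exactly when its finitely many `F`-coordinates are, so the zero set is a finite
intersection of zero sets over `F`. -/
theorem exists_isZeroSetPeriod_finiteDimensional {ι κ S F L : Type*} [CommRing S] [IsDomain S]
    [Field F] [Algebra S F] [IsFractionRing S F] (e : S ≃+* MvPolynomial ι ℤ) [Field L]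
    [Algebra F L] [FiniteDimensional F L] [Fintype κ] [DecidableEq κ]
    (A : Matrix κ κ L) (hA : A.det ≠ 0) (w v : κ → L) :
    ∃ N, IsZeroSetPeriod N {m | w ⬝ᵥ (A ^ m *ᵥ v) = 0} := by
  let T : (κ → L) →ₗ[F] (κ → L) := (Matrix.toLin' A).restrictScalars F
  have hT : Function.Injective T := Matrix.mulVec_injective_iff_isUnit.2
    ((Matrix.isUnit_iff_isUnit_det _).2 (isUnit_iff_ne_zero.2 hA))
  have hTpow : ∀ m, (T ^ m) v = A ^ m *ᵥ v := fun m => by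
    rw [← Matrix.toLin'_apply, Matrix.toLin'_pow, Module.End.pow_apply, Module.End.pow_apply]
    rfl
  let b := Module.finBasis F L
  let b' := Module.finBasis F (κ → L)
  let φ : (κ → L) →ₗ[F] L :=
    { toFun := fun x => w ⬝ᵥ x
      map_add' := dotProduct_add w
      map_smul' := fun a x => dotProduct_smul a w x }
  obtain ⟨N, hN⟩ := IsZeroSetPeriod.exists_iInter fun i =>
    exists_isZeroSetPeriod_fractionRing e _ (LinearMap.det_toMatrix_ne_zero_of_injective b' hT)
      (fun j => ((b.coord i).comp φ) (b' j)) (b'.repr v)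
  refine ⟨N, ?_⟩
  convert hN using 1
  ext m
  simp only [Set.mem_ofPred_eq, Set.mem_iInter, LinearMap.dotProduct_toMatrix_pow_mulVec_repr]
  simp only [LinearMap.comp_apply, hTpow]
  exact b.forall_coord_eq_zero_iff.symm

/-- The finitely many entries of `A`, `w` and `v` generate a finite extension of `F`. -/
theorem exists_isZeroSetPeriod_isAlgebraic {ι κ S F K : Type*} [CommRing S] [IsDomain S]
    [Field F] [Algebra S F] [IsFractionRing S F] (e : S ≃+* MvPolynomial ι ℤ) [Field K]
    [Algebra F K] [Algebra.IsAlgebraic F K] [Fintype κ] [DecidableEq κ]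
    (A : Matrix κ κ K) (hA : A.det ≠ 0) (w v : κ → K) :
    ∃ N, IsZeroSetPeriod N {m | w ⬝ᵥ (A ^ m *ᵥ v) = 0} := by
  set E : Set K := Set.range (fun ij : κ × κ => A ij.1 ij.2) ∪ Set.range w ∪ Set.range v
  have hEfin : E.Finite :=
    ((Set.finite_range _).union (Set.finite_range _)).union (Set.finite_range _)
  let L := IntermediateField.adjoin F E
  have : FiniteDimensional F L := by
    have := hEfin.to_subtype
    exact IntermediateField.finiteDimensional_adjoin fun x _ => Algebra.IsIntegral.isIntegral x
  have hmem : ∀ x ∈ E, x ∈ L := fun x hx => IntermediateField.subset_adjoin F E hx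
  let A' : Matrix κ κ L := Matrix.of fun i j => ⟨A i j, hmem _ (.inl (.inl ⟨(i, j), rfl⟩))⟩
  let w' : κ → L := fun i => ⟨w i, hmem _ (.inl (.inr ⟨i, rfl⟩))⟩
  let v' : κ → L := fun i => ⟨v i, hmem _ (.inr ⟨i, rfl⟩)⟩
  have hmap : ∀ m, algebraMap L K (w' ⬝ᵥ (A' ^ m *ᵥ v')) = w ⬝ᵥ (A ^ m *ᵥ v) :=
    (algebraMap L K).map_dotProduct_pow_mulVec A' w' v'
  have hdet : A'.det ≠ 0 := fun h => hA (by
    have : algebraMap L K A'.det = A.det := RingHom.map_det _ _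
    rw [← this, h, map_zero])
  obtain ⟨N, hN⟩ := exists_isZeroSetPeriod_finiteDimensional (F := F) e A' hdet w' v'
  refine ⟨N, ?_⟩
  convert hN using 3 with m
  rw [← hmap m, map_eq_zero_iff _ (algebraMap L K).injective]

theorem exists_isZeroSetPeriod_field {K κ : Type*} [Field K] [CharZero K] [Fintype κ]
    [DecidableEq κ] (A : Matrix κ κ K) (hA : A.det ≠ 0) (w v : κ → K) :
    ∃ N, IsZeroSetPeriod N {m | w ⬝ᵥ (A ^ m *ᵥ v) = 0} := by
  obtain ⟨s, hs⟩ := exists_isTranscendenceBasis ℤ K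
  set S := Algebra.adjoin ℤ (Set.range ((↑) : s → K))
  have e : S ≃+* MvPolynomial s ℤ := hs.1.aevalEquiv.symm.toRingEquiv
  let := FractionRing.liftAlgebra S K
  have := FractionRing.isScalarTower_liftAlgebra S K
  have : Algebra.IsAlgebraic (FractionRing S) K :=
    (IsFractionRing.comap_isAlgebraic_iff (A := S)).1 hs.isAlgebraic
  exact exists_isZeroSetPeriod_isAlgebraic (F := FractionRing S) e A hA w v

theorem mainTheorem5 {K : Type*} [Field K] [CharZero K] (n : ℕ)
    (σ : (Fin n → K) ≃ₗ[K] (Fin n → K)) (v : Fin n → K)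
    (W : Submodule K (Fin n → K)) (hW : Module.finrank K ((Fin n → K) ⧸ W) = 1) :
    ∃ (P : Set (Set ℕ)) (F : Set ℕ), P.Finite ∧ (∀ A ∈ P, IsNatArithProg A) ∧ F.Finite ∧
      {m : ℕ | (σ ^ m) v ∈ W} = ⋃₀ P ∪ F := by
  -- Since `W` has codimension one, it is the kernel of a linear form.
  let q : ((Fin n → K) ⧸ W) ≃ₗ[K] K :=
    LinearEquiv.ofFinrankEq _ _ (hW.trans (Module.finrank_self K).symm)
  let φ : (Fin n → K) →ₗ[K] K := q.toLinearMap ∘ₗ W.mkQ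
  have hφ : ∀ x, φ x = 0 ↔ x ∈ W := fun x => by simp [φ]
  let b := Pi.basisFun K (Fin n)
  obtain ⟨N, hN⟩ := exists_isZeroSetPeriod_field _
    (LinearMap.det_toMatrix_ne_zero_of_injective b (T := σ.toLinearMap) σ.injective)
    (fun i => φ (b i)) (b.repr v)
  simp only [LinearMap.dotProduct_toMatrix_pow_mulVec_repr, hφ, Module.End.pow_apply] at hN
  simp only [LinearEquiv.pow_apply]
  exact hN.eq_sUnion_union
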